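/- Let $(N,J,h)$ be an almost Hermitian manifold: $N$ is a smooth ($C^\infty$, finite-dimensional, Hausdorff) manifold without boundary, $h=\langle\cdot,\cdot\rangle$ is a smooth Riemannian metric on $N$, and $J$ is a smooth section of $\mathrm{End}(TN)$ with $J^2=-\mathrm{Id}$ and $\langle JX,JY\rangle=\langle X,Y\rangle$. A Hermitian connection on $N$ is a smooth affine connection $\nabla$ on $TN$ with $\nabla J=0$ and $\nabla h=0$; its torsion is $T(X,Y)=\nabla_XY-\nabla_YX-[X,Y]$. A $TN$-valued bilinear map $B$ is identified with the trilinear form $B(X,Y,Z)=\langle B(X,Y),Z\rangle$, and is called totally skew-symmetric if this form is a $3$-form. Let $$N_J(X,Y)=[JX,JY]-J[JX,Y]-J[X,JY]-[X,Y]$$ be the Nijenhuis tensor, $\Omega_J(X,Y)=\langle JX,Y\rangle$ the Kähler form, $d$ the exterior derivative, normalized by $d\beta(X,Y,Z)=X\beta(Y,Z)-Y\beta(X,Z)+Z\beta(X,Y)-\beta([X,Y],Z)+\beta([X,Z],Y)-\beta([Y,Z],X)$, and $$d^c\Omega_J(X,Y,Z)=-d\Omega_J(JX,JY,JZ).$$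 Theorem. The almost Hermitian manifold $(N,J,h)$ admits a Hermitian connection with totally skew-symmetric torsion if and only if $N_J$ is totally skew-symmetric (one then says that $(N,J,h)$ is a $\mathcal G_1$-manifold). In that case this connection $\nabla$ (the characteristic connection) is unique, its torsion is the $3$-form $$T=-d^c\Omega_J+N_J,$$ and $\nabla=\nabla^h+\tfrac12T$, where $\nabla^h$ is the Levi-Civita connection of $h$, i.e. $\nabla_XY=\nabla^h_XY+\tfrac12T(X,Y)$. -/

import Mathlib

open Bundle
open scoped Manifold ContDiff

noncomputable section

namespace AlmostHermitian

section Fields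

variable {E : Type*} [NormedAddCommGroup E] [NormedSpace ℝ E]
  {H : Type*} [TopologicalSpace H] {I : ModelWithCorners ℝ E H}
  {M : Type*} [TopologicalSpace M] [ChartedSpace H M]

/-- The vector field `J X`, for a field of endomorphisms `J` of the tangent bundle. -/
def applyField (J : Π x : M, TangentSpace I x →L[ℝ] TangentSpace I x)
    (X : Π x : M, TangentSpace I x) : Π x : M, TangentSpace I x :=
  fun x ↦ J x (X x)

/-- The expression `[JX, JY] - J[JX, Y] - J[X, JY] - [X, Y]` for vector fields `X` and `Y`. -/
def nijenhuisField (J : Π x : M, TangentSpace I x →L[ℝ] TangentSpace I x)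
    (X Y : Π x : M, TangentSpace I x) (x : M) : TangentSpace I x :=
  VectorField.mlieBracket I (applyField J X) (applyField J Y) x
    - J x (VectorField.mlieBracket I (applyField J X) Y x)
    - J x (VectorField.mlieBracket I X (applyField J Y) x)
    - VectorField.mlieBracket I X Y x

/-- The invariant formula
`X β(Y, Z) - Y β(X, Z) + Z β(X, Y) - β([X, Y], Z) + β([X, Z], Y) - β([Y, Z], X)`
for the exterior derivative of a 2-form `β` on vector fields `X`, `Y`, `Z`. -/
def extDerivField (β : Π x : M, TangentSpace I x →L[ℝ] TangentSpace I x →L[ℝ] ℝ)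
    (X Y Z : Π x : M, TangentSpace I x) (x : M) : ℝ :=
  d% (fun y ↦ β y (Y y) (Z y)) x (X x) - d% (fun y ↦ β y (X y) (Z y)) x (Y x)
    + d% (fun y ↦ β y (X y) (Y y)) x (Z x)
    - β x (VectorField.mlieBracket I X Y x) (Z x) + β x (VectorField.mlieBracket I X Z x) (Y x)
    - β x (VectorField.mlieBracket I Y Z x) (X x)

lemma applyField_smul (J : Π x : M, TangentSpace I x →L[ℝ] TangentSpace I x) (f : M → ℝ)
    (X : Π x : M, TangentSpace I x) : applyField J (f • X) = f • applyField J X := by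
  funext x; simp [applyField]

lemma applyField_add (J : Π x : M, TangentSpace I x →L[ℝ] TangentSpace I x)
    (X Y : Π x : M, TangentSpace I x) :
    applyField J (X + Y) = applyField J X + applyField J Y := by
  funext x; simp [applyField]

lemma nijenhuisField_swap (J : Π x : M, TangentSpace I x →L[ℝ] TangentSpace I x)
    (X Y : Π x : M, TangentSpace I x) (x : M) :
    nijenhuisField J X Y x = -nijenhuisField J Y X x := by
  unfold nijenhuisField
  rw [VectorField.mlieBracket_swap_apply (V := applyField J X) (W := applyField J Y),
    VectorField.mlieBracket_swap_apply (V := applyField J X) (W := Y),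
    VectorField.mlieBracket_swap_apply (V := X) (W := applyField J Y),
    VectorField.mlieBracket_swap_apply (V := X) (W := Y), map_neg, map_neg]
  abel

lemma extDerivField_swap₁ {β : Π x : M, TangentSpace I x →L[ℝ] TangentSpace I x →L[ℝ] ℝ}
    (X Y Z : Π x : M, TangentSpace I x) (x : M) (hβ' : ∀ x u v, β x u v = -β x v u) :
    extDerivField β X Y Z x = -extDerivField β Y X Z x := by
  have h : (fun y ↦ β y (X y) (Y y)) = -(fun y ↦ β y (Y y) (X y)) := by
    funext y; simp [hβ' y (X y)]
  unfold extDerivField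
  rw [h, VectorField.mlieBracket_swap_apply (V := X) (W := Y)]
  simp [mvfderiv_neg]
  ring

lemma extDerivField_swap₂ {β : Π x : M, TangentSpace I x →L[ℝ] TangentSpace I x →L[ℝ] ℝ}
    (X Y Z : Π x : M, TangentSpace I x) (x : M) (hβ' : ∀ x u v, β x u v = -β x v u) :
    extDerivField β X Y Z x = -extDerivField β X Z Y x := by
  have h : (fun y ↦ β y (Y y) (Z y)) = -(fun y ↦ β y (Z y) (Y y)) := by
    funext y; simp [hβ' y (Y y)]
  unfold extDerivField
  rw [h, VectorField.mlieBracket_swap_apply (V := Y) (W := Z)]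
  simp [mvfderiv_neg]
  ring

end Fields

section Tensors

variable {E : Type*} [NormedAddCommGroup E] [NormedSpace ℝ E]
  {H : Type*} [TopologicalSpace H] {I : ModelWithCorners ℝ E H}
  {M : Type*} [TopologicalSpace M] [ChartedSpace H M] [IsManifold I ∞ M]

/-- `J` is smooth as a section of the endomorphism bundle of the tangent bundle. -/
def IsSmoothEndomorphism (J : Π x : M, TangentSpace I x →L[ℝ] TangentSpace I x) : Prop :=
  ContMDiff I (I.prod 𝓘(ℝ, E →L[ℝ] E)) ∞
    (fun x ↦ TotalSpace.mk' (E →L[ℝ] E)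
      (E := fun x : M ↦ TangentSpace I x →L[ℝ] TangentSpace I x) x (J x))

/-- `β` is smooth as a section of the bundle of bilinear forms on the tangent bundle. -/
def IsSmoothBilinForm (β : Π x : M, TangentSpace I x →L[ℝ] TangentSpace I x →L[ℝ] ℝ) : Prop :=
  ContMDiff I (I.prod 𝓘(ℝ, E →L[ℝ] E →L[ℝ] ℝ)) ∞
    (fun x ↦ TotalSpace.mk' (E →L[ℝ] E →L[ℝ] ℝ)
      (E := fun x : M ↦ TangentSpace I x →L[ℝ] TangentSpace I x →L[ℝ] ℝ) x (β x))

/-- The Nijenhuis tensor of `J`: its value on two tangent vectors at `x` is computed on vector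
fields extending them. The choice of the extensions is irrelevant, see `nijenhuis_apply`. -/
def nijenhuis (J : Π x : M, TangentSpace I x →L[ℝ] TangentSpace I x)
    (x : M) (u v : TangentSpace I x) : TangentSpace I x :=
  nijenhuisField J (FiberBundle.extend E u) (FiberBundle.extend E v) x

/-- The exterior derivative of a 2-form `β`: its value on three tangent vectors at `x` is computed
on vector fields extending them. The choice of the extensions is irrelevant,
see `extDerivTwoForm_apply`. -/
def extDerivTwoForm (β : Π x : M, TangentSpace I x →L[ℝ] TangentSpace I x →L[ℝ] ℝ)
    (x : M) (u v w : TangentSpace I x) : ℝ :=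
  extDerivField β (FiberBundle.extend E u) (FiberBundle.extend E v) (FiberBundle.extend E w) x

lemma mdifferentiableAt_applyField
    {J : Π x : M, TangentSpace I x →L[ℝ] TangentSpace I x} (hJ : IsSmoothEndomorphism J) {x : M}
    {X : Π x : M, TangentSpace I x} (hX : MDiffAt (T% X) x) : MDiffAt (T% (applyField J X)) x :=
  MDifferentiableAt.clm_bundle_apply (F₁ := E) (F₂ := E)
    ((hJ x).mdifferentiableAt (by simp)) hX

lemma mdifferentiableAt_bilin_apply
    {β : Π x : M, TangentSpace I x →L[ℝ] TangentSpace I x →L[ℝ] ℝ} (hβ : IsSmoothBilinForm β)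
    {x : M} {X Y : Π x : M, TangentSpace I x} (hX : MDiffAt (T% X) x) (hY : MDiffAt (T% Y) x) :
    MDiffAt (fun y ↦ β y (X y) (Y y)) x := by
  have : MDifferentiableAt I (I.prod 𝓘(ℝ))
      (fun m ↦ TotalSpace.mk' ℝ (E := Bundle.Trivial M ℝ) m (β m (X m) (Y m))) x :=
    MDifferentiableAt.clm_bundle_apply₂ (F₁ := E) (F₂ := E)
      ((hβ x).mdifferentiableAt (by simp)) hX hY
  simp only [mdifferentiableAt_totalSpace] at this
  exact this.2

variable [CompleteSpace E]

lemma tensorial_nijenhuisField {J : Π x : M, TangentSpace I x →L[ℝ] TangentSpace I x}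
    (hJ : IsSmoothEndomorphism J) (hJ2 : ∀ x u, J x (J x u) = -u) (x : M)
    (Y : Π x : M, TangentSpace I x) :
    TensorialAt I E (nijenhuisField J · Y x) x where
  smul {f X} hf hX := by
    have hJX := mdifferentiableAt_applyField hJ hX
    simp only [nijenhuisField, applyField_smul, VectorField.mlieBracket_smul_left hf hX,
      VectorField.mlieBracket_smul_left hf hJX]
    simp [applyField, hJ2]
    module
  add {X X'} hX hX' := by
    have hJX := mdifferentiableAt_applyField hJ hX
    have hJX' := mdifferentiableAt_applyField hJ hX'
    simp only [nijenhuisField, applyField_add, VectorField.mlieBracket_add_left hX hX',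
      VectorField.mlieBracket_add_left hJX hJX', map_add]
    abel

lemma tensorial_extDerivField {β : Π x : M, TangentSpace I x →L[ℝ] TangentSpace I x →L[ℝ] ℝ}
    (hβ : IsSmoothBilinForm β) (x : M)
    {Y Z : Π x : M, TangentSpace I x} (hY : MDiffAt (T% Y) x) (hZ : MDiffAt (T% Z) x) :
    TensorialAt I E (extDerivField β · Y Z x) x where
  smul {f X} hf hX := by
    have h₁ := mvfderiv_fun_mul hf (mdifferentiableAt_bilin_apply hβ hX hY)
    have h₂ := mvfderiv_fun_mul hf (mdifferentiableAt_bilin_apply hβ hX hZ)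
    simp [extDerivField, VectorField.mlieBracket_smul_left hf hX, h₁, h₂]
    ring
  add {X X'} hX hX' := by
    have h₁ := mvfderiv_fun_add (mdifferentiableAt_bilin_apply hβ hX hY)
      (mdifferentiableAt_bilin_apply hβ hX' hY)
    have h₂ := mvfderiv_fun_add (mdifferentiableAt_bilin_apply hβ hX hZ)
      (mdifferentiableAt_bilin_apply hβ hX' hZ)
    simp [extDerivField, VectorField.mlieBracket_add_left hX hX', h₁, h₂]
    ring

variable [FiniteDimensional ℝ E]

/-- The Nijenhuis tensor may be computed on arbitrary differentiable vector fields. -/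
theorem nijenhuis_apply {J : Π x : M, TangentSpace I x →L[ℝ] TangentSpace I x}
    (hJ : IsSmoothEndomorphism J) (hJ2 : ∀ x u, J x (J x u) = -u) {x : M}
    {X Y : Π x : M, TangentSpace I x} (hX : MDiffAt (T% X) x) (hY : MDiffAt (T% Y) x) :
    nijenhuis J x (X x) (Y x) = nijenhuisField J X Y x := by
  have hX' : MDiffAt (T% (FiberBundle.extend E (X x))) x :=
    FiberBundle.mdifferentiableAt_extend ..
  have hY' : MDiffAt (T% (FiberBundle.extend E (Y x))) x :=
    FiberBundle.mdifferentiableAt_extend ..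
  unfold nijenhuis
  rw [(tensorial_nijenhuisField hJ hJ2 x _).pointwise hX' hX (by simp),
    nijenhuisField_swap, (tensorial_nijenhuisField hJ hJ2 x _).pointwise hY' hY (by simp),
    ← nijenhuisField_swap]

/-- The exterior derivative of a 2-form may be computed on arbitrary differentiable
vector fields. -/
theorem extDerivTwoForm_apply
    {β : Π x : M, TangentSpace I x →L[ℝ] TangentSpace I x →L[ℝ] ℝ}
    (hβ : IsSmoothBilinForm β) (hβ' : ∀ x u v, β x u v = -β x v u) {x : M}
    {X Y Z : Π x : M, TangentSpace I x} (hX : MDiffAt (T% X) x) (hY : MDiffAt (T% Y) x)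
    (hZ : MDiffAt (T% Z) x) :
    extDerivTwoForm β x (X x) (Y x) (Z x) = extDerivField β X Y Z x := by
  have hX' : MDiffAt (T% (FiberBundle.extend E (X x))) x :=
    FiberBundle.mdifferentiableAt_extend ..
  have hY' : MDiffAt (T% (FiberBundle.extend E (Y x))) x :=
    FiberBundle.mdifferentiableAt_extend ..
  have hZ' : MDiffAt (T% (FiberBundle.extend E (Z x))) x :=
    FiberBundle.mdifferentiableAt_extend ..
  unfold extDerivTwoForm
  rw [(tensorial_extDerivField hβ x hY' hZ').pointwise hX' hX (by simp),
    extDerivField_swap₁ _ _ _ _ hβ',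
    (tensorial_extDerivField hβ x hX hZ').pointwise hY' hY (by simp),
    extDerivField_swap₂ _ _ _ _ hβ', extDerivField_swap₁ _ _ _ _ hβ',
    (tensorial_extDerivField hβ x hY hX).pointwise hZ' hZ (by simp),
    ← extDerivField_swap₁ _ _ _ _ hβ', ← extDerivField_swap₂ _ _ _ _ hβ',
    ← extDerivField_swap₁ _ _ _ _ hβ']

end Tensors

section Hermitian

variable {E : Type*} [NormedAddCommGroup E] [NormedSpace ℝ E]
  {H : Type*} [TopologicalSpace H] {I : ModelWithCorners ℝ E H}
  {M : Type*} [TopologicalSpace M] [ChartedSpace H M] [IsManifold I ∞ M]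

/-- `(M, J, h)` is an almost Hermitian manifold: `J` is a smooth almost complex structure,
orthogonal for the smooth Riemannian metric `h`. -/
structure IsAlmostHermitian
    (h : ContMDiffRiemannianMetric I ∞ E (fun x : M ↦ TangentSpace I x))
    (J : Π x : M, TangentSpace I x →L[ℝ] TangentSpace I x) : Prop where
  smooth : IsSmoothEndomorphism J
  sq (x : M) (u : TangentSpace I x) : J x (J x u) = -u
  orthogonal (x : M) (u v : TangentSpace I x) : h.inner x (J x u) (J x v) = h.inner x u v

/-- The Kähler form `Ω_J(u, v) = ⟨J u, v⟩`. -/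
def kahlerForm (h : ContMDiffRiemannianMetric I ∞ E (fun x : M ↦ TangentSpace I x))
    (J : Π x : M, TangentSpace I x →L[ℝ] TangentSpace I x) (x : M) :
    TangentSpace I x →L[ℝ] TangentSpace I x →L[ℝ] ℝ :=
  (h.inner x).comp (J x)

/-- `d^c Ω_J (u, v, w) = -dΩ_J(J u, J v, J w)`. -/
def dcKahlerForm (h : ContMDiffRiemannianMetric I ∞ E (fun x : M ↦ TangentSpace I x))
    (J : Π x : M, TangentSpace I x →L[ℝ] TangentSpace I x)
    (x : M) (u v w : TangentSpace I x) : ℝ :=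
  -extDerivTwoForm (kahlerForm h J) x (J x u) (J x v) (J x w)

/-- A tangent-bundle-valued bilinear map `B` is totally skew-symmetric if the trilinear form
`⟨B(u, v), w⟩` changes sign under the transpositions `u ↔ v` and `v ↔ w`, i.e. is a 3-form. -/
def IsTotallySkew (h : ContMDiffRiemannianMetric I ∞ E (fun x : M ↦ TangentSpace I x))
    (B : Π x : M, TangentSpace I x → TangentSpace I x → TangentSpace I x) : Prop :=
  ∀ (x : M) (u v w : TangentSpace I x),
    h.inner x (B x u v) w = -h.inner x (B x v u) w ∧
    h.inner x (B x u v) w = -h.inner x (B x u w) v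

/-- `∇h = 0`. Here and below, `cov Y x u` is `(∇_u Y)(x)`. -/
def IsMetricConnection (h : ContMDiffRiemannianMetric I ∞ E (fun x : M ↦ TangentSpace I x))
    (cov : CovariantDerivative I E (fun x : M ↦ TangentSpace I x)) : Prop :=
  ∀ (x : M) (Y Z : Π x : M, TangentSpace I x), MDiffAt (T% Y) x → MDiffAt (T% Z) x →
    ∀ u : TangentSpace I x,
      d% (fun y ↦ h.inner y (Y y) (Z y)) x u =
        h.inner x (cov Y x u) (Z x) + h.inner x (Y x) (cov Z x u)

/-- `∇J = 0`, i.e. `∇_u (JY) = J ∇_u Y`. -/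
def IsComplexConnection (J : Π x : M, TangentSpace I x →L[ℝ] TangentSpace I x)
    (cov : CovariantDerivative I E (fun x : M ↦ TangentSpace I x)) : Prop :=
  ∀ (x : M) (Y : Π x : M, TangentSpace I x), MDiffAt (T% Y) x →
    ∀ u : TangentSpace I x, cov (applyField J Y) x u = J x (cov Y x u)

/-- A Hermitian connection: a smooth affine connection with `∇h = 0` and `∇J = 0`. -/
structure IsHermitianConnection
    (h : ContMDiffRiemannianMetric I ∞ E (fun x : M ↦ TangentSpace I x))
    (J : Π x : M, TangentSpace I x →L[ℝ] TangentSpace I x)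
    (cov : CovariantDerivative I E (fun x : M ↦ TangentSpace I x)) : Prop where
  smooth : cov.ContMDiffCovariantDerivative ∞
  metric : IsMetricConnection h cov
  complex : IsComplexConnection J cov

/-- Two affine connections are the same as differential operators: they agree at every point on
every vector field that is differentiable there. (`CovariantDerivative` is a function on arbitrary
vector fields, whose values at points of non-differentiability carry no meaning.) -/
def SameConnection (cov cov' : CovariantDerivative I E (fun x : M ↦ TangentSpace I x)) : Prop :=
  ∀ (x : M) (Y : Π x : M, TangentSpace I x), MDiffAt (T% Y) x →
    ∀ u : TangentSpace I x, cov Y x u = cov' Y x u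

/-- `∇ = ∇⁰ + c B`, i.e. `∇_u Y = ∇⁰_u Y + c B(u, Y)` for every differentiable vector field `Y`. -/
def IsSumConnection (cov cov₀ : CovariantDerivative I E (fun x : M ↦ TangentSpace I x)) (c : ℝ)
    (B : Π x : M, TangentSpace I x →L[ℝ] TangentSpace I x →L[ℝ] TangentSpace I x) : Prop :=
  ∀ (x : M) (Y : Π x : M, TangentSpace I x), MDiffAt (T% Y) x →
    ∀ u : TangentSpace I x, cov Y x u = cov₀ Y x u + c • B x u (Y x)

variable [FiniteDimensional ℝ E] [CompleteSpace E]

/-- A Hermitian connection with totally skew-symmetric torsion. -/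
structure IsCharacteristicConnection
    (h : ContMDiffRiemannianMetric I ∞ E (fun x : M ↦ TangentSpace I x))
    (J : Π x : M, TangentSpace I x →L[ℝ] TangentSpace I x)
    (cov : CovariantDerivative I E (fun x : M ↦ TangentSpace I x)) : Prop where
  hermitian : IsHermitianConnection h J cov
  skew : IsTotallySkew h (fun x u v ↦ cov.torsion x u v)

/-- The Levi-Civita connection of `h`: smooth, metric and torsion free. -/
structure IsLeviCivita (h : ContMDiffRiemannianMetric I ∞ E (fun x : M ↦ TangentSpace I x))
    (cov : CovariantDerivative I E (fun x : M ↦ TangentSpace I x)) : Prop where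
  smooth : cov.ContMDiffCovariantDerivative ∞
  metric : IsMetricConnection h cov
  torsionFree : cov.torsion = 0

end Hermitian

end AlmostHermitian

end

/-! A metric connection with totally skew torsion $T$ satisfies a Koszul formula in which the
torsion contributes just $\tfrac12\langle T(X,Y),Z\rangle$ (`IsMetricConnection.inner_eq_koszul`).
Such a connection is thus $\nabla^h+\tfrac12T$ and is determined by $T$; conversely every smooth
3-form is the torsion of one (`exists_isMetricConnection_torsion_eq`).

Write $A(X,Y,Z)=\langle(\nabla_XJ)Y,Z\rangle$. For a metric connection, replacing brackets and
derivatives by $\nabla$ expresses $N_J$ and $d\Omega_J$ through $A$ and $T$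
(`nijenhuisField_eq_torsion`, `extDerivField_kahlerForm_eq`). If $A=0$, the first formula makes
$N_J$ totally skew when $T$ is, and together the two solve for $T=-d^c\Omega_J+N_J$. Existence
starts from the metric connection whose torsion is this 3-form, available when $N_J$ is totally
skew. The torsion terms in the same two formulas then cancel, and what remains is that each cyclic
permutation of $A$ is the sum of the other two; hence $A=0$
(`IsMetricConnection.isComplexConnection`). -/

noncomputable section

namespace AlmostHermitian

/-! ### Smoothness of determinants, directional derivatives, brackets and the resulting tensors. -/

section Smoothness

variable {E : Type*} [NormedAddCommGroup E] [NormedSpace ℝ E]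
  {H : Type*} [TopologicalSpace H] {I : ModelWithCorners ℝ E H}
  {M : Type*} [TopologicalSpace M] [ChartedSpace H M]

lemma contMDiffAt_det {ι : Type*} [Fintype ι] [DecidableEq ι] {x : M} {A : M → Matrix ι ι ℝ}
    (hA : ∀ i j, CMDiffAt ∞ (fun y ↦ A y i j) x) : CMDiffAt ∞ (fun y ↦ (A y).det) x := by
  simp only [Matrix.det_apply']
  exact contMDiffAt_finsetSum fun σ _ ↦
    contMDiffAt_const.mul (contMDiffAt_finsetProd fun i _ ↦ hA (σ i) i)

variable [IsManifold I ∞ M]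

lemma contMDiffAt_applyField {J : Π x : M, TangentSpace I x →L[ℝ] TangentSpace I x}
    (hJ : IsSmoothEndomorphism J) {x : M} {X : Π x : M, TangentSpace I x}
    (hX : CMDiffAt ∞ (T% X) x) : CMDiffAt ∞ (T% (applyField J X)) x :=
  ContMDiffAt.clm_bundle_apply (F₁ := E) (F₂ := E) (hJ x) hX

lemma contMDiffAt_bilin_apply {β : Π x : M, TangentSpace I x →L[ℝ] TangentSpace I x →L[ℝ] ℝ}
    (hβ : IsSmoothBilinForm β) {x : M} {X Y : Π x : M, TangentSpace I x}
    (hX : CMDiffAt ∞ (T% X) x) (hY : CMDiffAt ∞ (T% Y) x) :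
    CMDiffAt ∞ (fun y ↦ β y (X y) (Y y)) x := by
  have : ContMDiffAt I (I.prod 𝓘(ℝ)) ∞
      (fun m ↦ TotalSpace.mk' ℝ (E := Bundle.Trivial M ℝ) m (β m (X m) (Y m))) x :=
    ContMDiffAt.clm_bundle_apply₂ (F₁ := E) (F₂ := E) (hβ x) hX hY
  simp only [contMDiffAt_totalSpace] at this
  exact this.2

lemma contMDiffAt_mvfderiv_apply {f : M → ℝ} {x : M} {X : Π x : M, TangentSpace I x}
    (hf : CMDiffAt ∞ f x) (hX : CMDiffAt ∞ (T% X) x) :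
    CMDiffAt ∞ (fun y ↦ d% f y (X y)) x := by
  have h₁ := hf.mfderiv_const (m := ∞) (by simp)
  have h₂ := ContMDiffAt.clm_apply_of_inCoordinates (E₁ := fun y : M ↦ TangentSpace I y)
    (E₂ := fun y : ℝ ↦ TangentSpace 𝓘(ℝ, ℝ) y) (b₁ := id) (b₂ := f)
    (ϕ := fun y ↦ mfderiv% f y) (v := X) h₁ hX hf
  rw [contMDiffAt_totalSpace] at h₂
  simpa using! h₂.2

lemma contMDiffAt_mlieBracket [CompleteSpace E] {x : M} {X Y : Π x : M, TangentSpace I x}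
    (hX : CMDiffAt ∞ (T% X) x) (hY : CMDiffAt ∞ (T% Y) x) :
    CMDiffAt ∞ (T% (VectorField.mlieBracket I X Y)) x := by
  -- Since $\infty+1=\infty$, the bracket loses no regularity.
  have : IsManifold I ((⊤ : ℕ∞) + 1) M := ‹IsManifold I ∞ M›
  have : IsManifold I (minSmoothness ℝ 2) M := by simp only [minSmoothness_of_isRCLikeNormedField]; infer_instance
  exact ContMDiffAt.mlieBracket_vectorField (m := ⊤) (n := ⊤) hX hY (by simp)

lemma contMDiffAt_nijenhuisField [CompleteSpace E]
    {J : Π x : M, TangentSpace I x →L[ℝ] TangentSpace I x}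
    (hJ : IsSmoothEndomorphism J) {x : M} {X Y : Π x : M, TangentSpace I x}
    (hX : CMDiffAt ∞ (T% X) x) (hY : CMDiffAt ∞ (T% Y) x) :
    CMDiffAt ∞ (T% (nijenhuisField J X Y)) x := by
  have hJX := contMDiffAt_applyField hJ hX
  have hJY := contMDiffAt_applyField hJ hY
  exact (((contMDiffAt_mlieBracket hJX hJY).sub_section
    (contMDiffAt_applyField hJ (contMDiffAt_mlieBracket hJX hY))).sub_section
    (contMDiffAt_applyField hJ (contMDiffAt_mlieBracket hX hJY))).sub_section
    (contMDiffAt_mlieBracket hX hY)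

lemma contMDiffAt_extDerivField [CompleteSpace E]
    {β : Π x : M, TangentSpace I x →L[ℝ] TangentSpace I x →L[ℝ] ℝ}
    (hβ : IsSmoothBilinForm β) {x : M} {X Y Z : Π x : M, TangentSpace I x}
    (hX : CMDiffAt ∞ (T% X) x) (hY : CMDiffAt ∞ (T% Y) x) (hZ : CMDiffAt ∞ (T% Z) x) :
    CMDiffAt ∞ (extDerivField β X Y Z) x :=
  ((((contMDiffAt_mvfderiv_apply (contMDiffAt_bilin_apply hβ hY hZ) hX).sub
    (contMDiffAt_mvfderiv_apply (contMDiffAt_bilin_apply hβ hX hZ) hY)).add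
    (contMDiffAt_mvfderiv_apply (contMDiffAt_bilin_apply hβ hX hY) hZ)).sub
    (contMDiffAt_bilin_apply hβ (contMDiffAt_mlieBracket hX hY) hZ)).add
    (contMDiffAt_bilin_apply hβ (contMDiffAt_mlieBracket hX hZ) hY) |>.sub
    (contMDiffAt_bilin_apply hβ (contMDiffAt_mlieBracket hY hZ) hX)

end Smoothness

/-! ### Testing smoothness on local frames. -/

section Frames

variable {E : Type*} [NormedAddCommGroup E] [NormedSpace ℝ E]
  {H : Type*} [TopologicalSpace H] {I : ModelWithCorners ℝ E H}
  {M : Type*} [TopologicalSpace M] [ChartedSpace H M] [IsManifold I ∞ M]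
  {ι : Type*} [Fintype ι]

/-- A kernel vector of the Gram matrix gives a combination of the $s_i$ orthogonal to every $s_i$,
hence to itself; positivity makes it vanish. -/
lemma gram_det_ne_zero [DecidableEq ι]
    (h : ContMDiffRiemannianMetric I ∞ E (fun x : M ↦ TangentSpace I x))
    {x : M} {s : ι → TangentSpace I x} (hs : LinearIndependent ℝ s) :
    (Matrix.of fun i j ↦ h.inner x (s i) (s j)).det ≠ 0 := by
  intro h0
  obtain ⟨v, hv, hv0⟩ := Matrix.exists_mulVec_eq_zero_iff.mpr h0
  have hi (i : ι) : h.inner x (s i) (∑ j, v j • s j) = 0 := by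
    have := congrFun hv0 i
    simpa [Matrix.mulVec, dotProduct, mul_comm] using this
  have hw : ∑ j, v j • s j = 0 := by
    by_contra hne
    refine (h.pos x _ hne).ne' ?_
    have hsum (w : TangentSpace I x) (hw : ∀ i, h.inner x (s i) w = 0) :
        h.inner x (∑ j, v j • s j) w = 0 := by simp [hw]
    exact hsum _ hi
  exact hv (funext fun i ↦ Fintype.linearIndependent_iff.mp hs v hw i)

/-- A vector field is smooth at a point as soon as its inner products with a local frame are. -/
lemma contMDiffAt_section_of_inner [FiniteDimensional ℝ E]
    (h : ContMDiffRiemannianMetric I ∞ E (fun x : M ↦ TangentSpace I x))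
    {s : ι → Π x : M, TangentSpace I x} {u : Set M} (hs : IsLocalFrameOn I E ∞ s u)
    (hu : IsOpen u) {x : M} (hx : x ∈ u) {X : Π x : M, TangentSpace I x}
    (hX : ∀ i, CMDiffAt ∞ (fun y ↦ h.inner y (s i y) (X y)) x) : CMDiffAt ∞ (T% X) x := by
  classical
  have hs' (i : ι) : CMDiffAt ∞ (T% (s i)) x := hs.contMDiffAt hu hx i
  let G (y : M) : Matrix ι ι ℝ := Matrix.of fun i j ↦ h.inner y (s i y) (s j y)
  let r (y : M) (i : ι) : ℝ := h.inner y (s i y) (X y)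
  have hG (i j) : CMDiffAt ∞ (fun y ↦ G y i j) x :=
    contMDiffAt_bilin_apply h.contMDiff (hs' i) (hs' j)
  have hG0 {y : M} (hy : y ∈ u) : (G y).det ≠ 0 :=
    gram_det_ne_zero h (hs.linearIndependent hy)
  -- By Cramer's rule the frame coefficients of `X` are quotients of determinants in the Gram matrix
  -- and the inner products `r`; the denominator does not vanish on `u`.
  have hc (i : ι) : CMDiffAt ∞ (fun y ↦ (G y).cramer (r y) i / (G y).det) x := by
    simp only [Matrix.cramer_apply]
    refine ContMDiffAt.div₀ (contMDiffAt_det fun j k ↦ ?_) (contMDiffAt_det hG) (hG0 hx)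
    by_cases hk : k = i
    · subst hk
      simpa using hX j
    · simpa [hk] using hG j k
  refine hs.contMDiffAt_of_coeff_aux (fun i ↦ ?_) hu hx
  refine (hc i).congr_of_eventuallyEq ?_
  filter_upwards [hu.mem_nhds hx] with y hy
  have hr : (G y).mulVec (fun j ↦ hs.coeff j y (X y)) = r y := by
    funext i
    conv_rhs => simp only [r]; rw [hs.coeff_sum_eq X hy]
    simp [Matrix.mulVec, dotProduct, G, mul_comm]
  have : (G y).cramer (r y) i = (G y).det * hs.coeff i y (X y) := by
    rw [← hr, Matrix.cramer_eq_adjugate_mulVec, Matrix.mulVec_mulVec, Matrix.adjugate_mul]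
    simp [Matrix.smul_mulVec]
  simp only [LinearMap.piApply_apply]
  rw [this, mul_div_cancel_left₀ _ (hG0 hy)]

/-- A field of endomorphisms is smooth at a point as soon as its values on the local frame
given by a trivialization are. -/
lemma contMDiffAt_endomorphism_of_localFrame (b : Module.Basis ι ℝ E) {x : M}
    {A : Π x : M, TangentSpace I x →L[ℝ] TangentSpace I x}
    (hA : ∀ i, CMDiffAt ∞
      (T% (fun y ↦ A y ((trivializationAt E (fun x : M ↦ TangentSpace I x) x).localFrame b i y))) x) :
    ContMDiffAt I (I.prod 𝓘(ℝ, E →L[ℝ] E)) ∞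
      (fun y ↦ TotalSpace.mk' (E →L[ℝ] E)
        (E := fun x : M ↦ TangentSpace I x →L[ℝ] TangentSpace I x) y (A y)) x := by
  have : FiniteDimensional ℝ E := b.finiteDimensional_of_finite
  rw [contMDiffAt_hom_bundle]
  refine ⟨contMDiffAt_id, ?_⟩
  let P (i : ι) : E →L[ℝ] ℝ := LinearMap.toContinuousLinearMap (b.coord i)
  let e := trivializationAt E (fun x : M ↦ TangentSpace I x) x
  -- In coordinates an endomorphism is $\sum_i b^i\otimes\varphi(b_i)$, which is continuous linear
  -- in the values $\varphi(b_i)$.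
  have hsum (φ : E →L[ℝ] E) : φ = ∑ i, ContinuousLinearMap.smulRightL ℝ E E (P i) (φ (b i)) := by
    ext v
    calc φ v = φ (∑ i, b.repr v i • b i) := by rw [b.sum_repr]
      _ = _ := by rw [map_sum]; simp [P]
  have hterm : CMDiffAt ∞ (fun y ↦ ∑ i, ContinuousLinearMap.smulRightL ℝ E E (P i)
      (e ⟨y, A y (e.localFrame b i y)⟩).2) x := by
    refine contMDiffAt_finsetSum fun i _ ↦ ?_
    have h1 := (contMDiffAt_totalSpace.mp (hA i)).2
    exact (ContinuousLinearMap.contMDiff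
      (ContinuousLinearMap.smulRightL ℝ E E (P i))).contMDiffAt.comp x h1
  refine hterm.congr_of_eventuallyEq ?_
  filter_upwards [e.open_baseSet.mem_nhds (FiberBundle.mem_baseSet_trivializationAt' x)] with y hy
  rw [hsum (ContinuousLinearMap.inCoordinates _ _ _ _ _ _ _ _ _)]
  refine Finset.sum_congr rfl fun i _ ↦ ?_
  rw [ContinuousLinearMap.inCoordinates_eq hy hy]
  congr 1
  simp [e, Trivialization.localFrame_apply_of_mem_baseSet _ _ hy, Trivialization.basisAt]

end Frames

/-! ### Connections defined by their inner products $\langle\nabla_XY,Z\rangle$. -/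

section Construction

variable {E : Type*} [NormedAddCommGroup E] [NormedSpace ℝ E]
  {H : Type*} [TopologicalSpace H] {I : ModelWithCorners ℝ E H}
  {M : Type*} [TopologicalSpace M] [ChartedSpace H M] [IsManifold I ∞ M]

lemma eq_of_inner_eq (h : ContMDiffRiemannianMetric I ∞ E (fun x : M ↦ TangentSpace I x))
    {x : M} {u v : TangentSpace I x} (huv : ∀ w, h.inner x u w = h.inner x v w) : u = v := by
  by_contra hne
  have := h.pos x (u - v) (sub_ne_zero.mpr hne)
  simp [huv] at this

lemma exists_inner_eq [FiniteDimensional ℝ E]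
    (h : ContMDiffRiemannianMetric I ∞ E (fun x : M ↦ TangentSpace I x)) (x : M)
    (B : TangentSpace I x →L[ℝ] TangentSpace I x →L[ℝ] ℝ) :
    ∃ A : TangentSpace I x →L[ℝ] TangentSpace I x, ∀ u w, h.inner x (A u) w = B u w := by
  have : FiniteDimensional ℝ (TangentSpace I x) := inferInstanceAs (FiniteDimensional ℝ E)
  have : T2Space (TangentSpace I x) := inferInstanceAs (T2Space E)
  let Q : LinearMap.BilinForm ℝ (TangentSpace I x) := (h.inner x).toBilinForm
  have hQ : Q.Nondegenerate := by
    refine (LinearMap.BilinForm.nondegenerate_iff' Q (fun u ↦ ?_) ⟨h.symm x⟩).mpr (h.pos x)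
    by_cases hu : u = 0
    · simp [hu]
    · exact (h.pos x u hu).le
  refine ⟨LinearMap.toContinuousLinearMap
    ((Q.toDual hQ).symm.toLinearMap ∘ₗ (B.toBilinForm : TangentSpace I x →ₗ[ℝ] _)), fun u w ↦ ?_⟩
  exact LinearMap.BilinForm.apply_toDual_symm_apply (B := Q) (hB := hQ) (B.toBilinForm u) w

/-- A connection is determined by the functions `⟨∇_X Y, Z⟩`: a function `Φ` of three vector
fields, tensorial in the first and the last, and additive and satisfying the Leibniz rule in the
second, is of this form. -/
lemma exists_connection_inner_eq [FiniteDimensional ℝ E]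
    (h : ContMDiffRiemannianMetric I ∞ E (fun x : M ↦ TangentSpace I x))
    (Φ : (X Y Z : Π x : M, TangentSpace I x) → M → ℝ)
    (tensorial_left : ∀ {x} {Y Z : Π x : M, TangentSpace I x}, MDiffAt (T% Y) x →
      MDiffAt (T% Z) x → TensorialAt I E (Φ · Y Z x) x)
    (tensorial_right : ∀ {x} {X Y : Π x : M, TangentSpace I x}, MDiffAt (T% X) x →
      MDiffAt (T% Y) x → TensorialAt I E (Φ X Y · x) x)
    (add : ∀ {x} {X Y Y' Z : Π x : M, TangentSpace I x}, MDiffAt (T% X) x → MDiffAt (T% Y) x →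
      MDiffAt (T% Y') x → MDiffAt (T% Z) x → Φ X (Y + Y') Z x = Φ X Y Z x + Φ X Y' Z x)
    (leibniz : ∀ {x} {f : M → ℝ} {X Y Z : Π x : M, TangentSpace I x}, MDiffAt f x →
      MDiffAt (T% X) x → MDiffAt (T% Y) x → MDiffAt (T% Z) x →
      Φ X (f • Y) Z x = f x * Φ X Y Z x + d% f x (X x) * h.inner x (Y x) (Z x))
    (smooth : ∀ {x} {X Y Z : Π x : M, TangentSpace I x}, CMDiffAt ∞ (T% X) x →
      CMDiffAt ∞ (T% Y) x → CMDiffAt ∞ (T% Z) x → CMDiffAt ∞ (Φ X Y Z) x) :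
    ∃ cov : CovariantDerivative I E (fun x : M ↦ TangentSpace I x),
      cov.ContMDiffCovariantDerivative ∞ ∧
      ∀ {x} {X Y Z : Π x : M, TangentSpace I x}, MDiffAt (T% X) x → MDiffAt (T% Y) x →
        MDiffAt (T% Z) x → h.inner x (cov Y x (X x)) (Z x) = Φ X Y Z x := by
  have key (Y : Π x : M, TangentSpace I x) (x : M) :
      ∃ A : TangentSpace I x →L[ℝ] TangentSpace I x, MDiffAt (T% Y) x →
        ∀ {X Z : Π x : M, TangentSpace I x}, MDiffAt (T% X) x → MDiffAt (T% Z) x →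
          h.inner x (A (X x)) (Z x) = Φ X Y Z x := by
    by_cases hY : MDiffAt (T% Y) x
    · obtain ⟨A, hA⟩ := exists_inner_eq h x (TensorialAt.mkHom₂ (Φ · Y · x) x
        (fun _ hZ ↦ tensorial_left hY hZ) (fun _ hX ↦ tensorial_right hX hY))
      exact ⟨A, fun _ X Z hX hZ ↦ by rw [hA, TensorialAt.mkHom₂_apply _ _ hX hZ]⟩
    -- The value at points where `Y` is not differentiable is arbitrary: the axioms of a covariant
    -- derivative concern only differentiable sections.
    · exact ⟨0, fun hY' ↦ absurd hY' hY⟩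
  choose A hA using key
  have hext (x : M) (u : TangentSpace I x) : MDiffAt (T% (FiberBundle.extend E u)) x :=
    FiberBundle.mdifferentiableAt_extend ..
  have hA' {Y : Π x : M, TangentSpace I x} {x : M} (hY : MDiffAt (T% Y) x)
      (u w : TangentSpace I x) : h.inner x (A Y x u) w =
        Φ (FiberBundle.extend E u) Y (FiberBundle.extend E w) x := by
    rw [← hA Y x hY (hext x u) (hext x w)]
    simp
  refine ⟨⟨A, ⟨fun {Y Y' x} hY hY' _ ↦ ?_, fun {Y f x} hY hf _ ↦ ?_⟩⟩, ⟨⟨fun {Y} hY ↦ ?_⟩⟩,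
    fun {x X Y Z} hX hY hZ ↦ hA Y x hY hX hZ⟩
  · ext1 u
    refine eq_of_inner_eq h fun w ↦ ?_
    rw [hA' (mdifferentiableAt_add_section hY hY'), add (hext x u) hY hY' (hext x w),
      add_apply, map_add, add_apply, hA' hY, hA' hY']
  · ext1 u
    refine eq_of_inner_eq h fun w ↦ ?_
    rw [hA' (hf.smul_section hY), leibniz hf (hext x u) hY (hext x w)]
    simp [hA' hY]
  · intro x _
    refine ContMDiffAt.contMDiffWithinAt ?_
    let b := Module.finBasis ℝ E
    let e := trivializationAt E (fun x : M ↦ TangentSpace I x) x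
    have hx : x ∈ e.baseSet := FiberBundle.mem_baseSet_trivializationAt' x
    have he := e.isLocalFrameOn_localFrame_baseSet I ∞ b
    -- Smoothness of $\nabla Y$ is tested on frame fields $s_i$, and each $\nabla_{s_i}Y$ on its
    -- inner products with the $s_j$. This reduces it to smoothness of $\Phi(s_i,Y,s_j)$.
    refine contMDiffAt_endomorphism_of_localFrame b fun i ↦ ?_
    refine contMDiffAt_section_of_inner h he e.open_baseSet hx fun j ↦ ?_
    have hs {y : M} (hy : y ∈ e.baseSet) (i) : CMDiffAt ∞ (T% (e.localFrame b i)) y :=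
      he.contMDiffAt e.open_baseSet hy i
    have hY' (y : M) : CMDiffAt ∞ (T% Y) y := (hY y trivial).contMDiffAt Filter.univ_mem
    refine (smooth (hs hx i) (hY' x) (hs hx j)).congr_of_eventuallyEq ?_
    filter_upwards [e.open_baseSet.mem_nhds hx] with y hy
    rw [h.symm, ← hA Y y ((hY' y).mdifferentiableAt (by simp))
      ((hs hy i).mdifferentiableAt (by simp)) ((hs hy j).mdifferentiableAt (by simp))]

end Construction

/-! ### The Koszul formula with torsion, and the Levi-Civita connection. -/

section Koszul

variable {E : Type*} [NormedAddCommGroup E] [NormedSpace ℝ E]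
  {H : Type*} [TopologicalSpace H] {I : ModelWithCorners ℝ E H}
  {M : Type*} [TopologicalSpace M] [ChartedSpace H M] [IsManifold I ∞ M]

/-- The right-hand side of the Koszul formula for `⟨∇_X Y, Z⟩`. -/
def koszul (h : ContMDiffRiemannianMetric I ∞ E (fun x : M ↦ TangentSpace I x))
    (X Y Z : Π x : M, TangentSpace I x) (x : M) : ℝ :=
  (d% (fun y ↦ h.inner y (Y y) (Z y)) x (X x) + d% (fun y ↦ h.inner y (X y) (Z y)) x (Y x)
    - d% (fun y ↦ h.inner y (X y) (Y y)) x (Z x)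
    + h.inner x (VectorField.mlieBracket I X Y x) (Z x)
    - h.inner x (VectorField.mlieBracket I X Z x) (Y x)
    - h.inner x (VectorField.mlieBracket I Y Z x) (X x)) / 2

variable (h : ContMDiffRiemannianMetric I ∞ E (fun x : M ↦ TangentSpace I x))
  {x : M} {X Y Z : Π x : M, TangentSpace I x}

/-- This is metric compatibility at the level of the Koszul expression. With `koszul_sub_swap_left`,
which is torsion-freeness, it transports the linearity computed in the first slot to the other two.
-/
lemma koszul_add_swap_right (X Y Z : Π x : M, TangentSpace I x) (x : M) :
    koszul h X Y Z x + koszul h X Z Y x = d% (fun y ↦ h.inner y (Y y) (Z y)) x (X x) := by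
  simp only [koszul, fun y ↦ h.symm y (Z y) (Y y)]
  rw [VectorField.mlieBracket_swap_apply (V := Z) (W := Y)]
  simp
  ring

lemma koszul_sub_swap_left (X Y Z : Π x : M, TangentSpace I x) (x : M) :
    koszul h X Y Z x - koszul h Y X Z x = h.inner x (VectorField.mlieBracket I X Y x) (Z x) := by
  simp only [koszul, fun y ↦ h.symm y (Y y) (X y)]
  rw [VectorField.mlieBracket_swap_apply (V := Y) (W := X)]
  simp
  ring

variable [CompleteSpace E]

lemma contMDiffAt_koszul (hX : CMDiffAt ∞ (T% X) x) (hY : CMDiffAt ∞ (T% Y) x)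
    (hZ : CMDiffAt ∞ (T% Z) x) : CMDiffAt ∞ (koszul h X Y Z) x := by
  have hh : IsSmoothBilinForm h.inner := h.contMDiff
  exact ((((((contMDiffAt_mvfderiv_apply (contMDiffAt_bilin_apply hh hY hZ) hX).add
    (contMDiffAt_mvfderiv_apply (contMDiffAt_bilin_apply hh hX hZ) hY)).sub
    (contMDiffAt_mvfderiv_apply (contMDiffAt_bilin_apply hh hX hY) hZ)).add
    (contMDiffAt_bilin_apply hh (contMDiffAt_mlieBracket hX hY) hZ)).sub
    (contMDiffAt_bilin_apply hh (contMDiffAt_mlieBracket hX hZ) hY)).sub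
    (contMDiffAt_bilin_apply hh (contMDiffAt_mlieBracket hY hZ) hX)).div_const 2

lemma koszul_add_left {X' : Π x : M, TangentSpace I x} (hX : MDiffAt (T% X) x)
    (hX' : MDiffAt (T% X') x) (hY : MDiffAt (T% Y) x) (hZ : MDiffAt (T% Z) x) :
    koszul h (X + X') Y Z x = koszul h X Y Z x + koszul h X' Y Z x := by
  have hh : IsSmoothBilinForm h.inner := h.contMDiff
  have h₁ := mvfderiv_fun_add (mdifferentiableAt_bilin_apply hh hX hY)
    (mdifferentiableAt_bilin_apply hh hX' hY)
  have h₂ := mvfderiv_fun_add (mdifferentiableAt_bilin_apply hh hX hZ)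
    (mdifferentiableAt_bilin_apply hh hX' hZ)
  simp [koszul, VectorField.mlieBracket_add_left hX hX', h₁, h₂]
  ring

lemma koszul_smul_left {f : M → ℝ} (hf : MDiffAt f x) (hX : MDiffAt (T% X) x)
    (hY : MDiffAt (T% Y) x) (hZ : MDiffAt (T% Z) x) :
    koszul h (f • X) Y Z x = f x * koszul h X Y Z x := by
  have hh : IsSmoothBilinForm h.inner := h.contMDiff
  have h₁ := mvfderiv_fun_mul hf (mdifferentiableAt_bilin_apply hh hX hY)
  have h₂ := mvfderiv_fun_mul hf (mdifferentiableAt_bilin_apply hh hX hZ)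
  simp [koszul, VectorField.mlieBracket_smul_left hf hX, h₁, h₂]
  ring

lemma koszul_add_middle {Y' : Π x : M, TangentSpace I x} (hX : MDiffAt (T% X) x)
    (hY : MDiffAt (T% Y) x) (hY' : MDiffAt (T% Y') x) (hZ : MDiffAt (T% Z) x) :
    koszul h X (Y + Y') Z x = koszul h X Y Z x + koszul h X Y' Z x := by
  have h₁ := koszul_sub_swap_left h X (Y + Y') Z x
  rw [koszul_add_left h hY hY' hX hZ, VectorField.mlieBracket_add_right hY hY', map_add,
    add_apply] at h₁
  linear_combination h₁ - koszul_sub_swap_left h X Y Z x - koszul_sub_swap_left h X Y' Z x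

lemma koszul_smul_middle {f : M → ℝ} (hf : MDiffAt f x) (hX : MDiffAt (T% X) x)
    (hY : MDiffAt (T% Y) x) (hZ : MDiffAt (T% Z) x) :
    koszul h X (f • Y) Z x =
      f x * koszul h X Y Z x + d% f x (X x) * h.inner x (Y x) (Z x) := by
  have h₁ := koszul_sub_swap_left h X (f • Y) Z x
  rw [koszul_smul_left h hf hY hX hZ, VectorField.mlieBracket_smul_right hf hY] at h₁
  simp at h₁
  linear_combination h₁ - f x * koszul_sub_swap_left h X Y Z x

lemma koszul_add_right {Z' : Π x : M, TangentSpace I x} (hX : MDiffAt (T% X) x)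
    (hY : MDiffAt (T% Y) x) (hZ : MDiffAt (T% Z) x) (hZ' : MDiffAt (T% Z') x) :
    koszul h X Y (Z + Z') x = koszul h X Y Z x + koszul h X Y Z' x := by
  have hh : IsSmoothBilinForm h.inner := h.contMDiff
  have h₁ := koszul_add_swap_right h X Y (Z + Z') x
  have h₂ := mvfderiv_fun_add (mdifferentiableAt_bilin_apply hh hY hZ)
    (mdifferentiableAt_bilin_apply hh hY hZ')
  simp [koszul_add_middle h hX hZ hZ' hY, h₂] at h₁
  linear_combination h₁ - koszul_add_swap_right h X Y Z x - koszul_add_swap_right h X Y Z' x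

lemma koszul_smul_right {f : M → ℝ} (hf : MDiffAt f x) (hX : MDiffAt (T% X) x)
    (hY : MDiffAt (T% Y) x) (hZ : MDiffAt (T% Z) x) :
    koszul h X Y (f • Z) x = f x * koszul h X Y Z x := by
  have hh : IsSmoothBilinForm h.inner := h.contMDiff
  have h₁ := koszul_add_swap_right h X Y (f • Z) x
  have h₂ := mvfderiv_fun_mul hf (mdifferentiableAt_bilin_apply hh hY hZ)
  simp [koszul_smul_middle h hf hX hZ hY, h₂] at h₁
  linear_combination h₁ - f x * koszul_add_swap_right h X Y Z x
    - d% f x (X x) * h.symm x (Z x) (Y x)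

variable [FiniteDimensional ℝ E]

/-- The Koszul formula for a metric connection with totally skew-symmetric torsion. -/
theorem IsMetricConnection.inner_eq_koszul {h}
    {cov : CovariantDerivative I E (fun x : M ↦ TangentSpace I x)} (hcov : IsMetricConnection h cov)
    (hskew : IsTotallySkew h (fun x u v ↦ cov.torsion x u v)) (hX : MDiffAt (T% X) x)
    (hY : MDiffAt (T% Y) x) (hZ : MDiffAt (T% Z) x) :
    h.inner x (cov Y x (X x)) (Z x) =
      koszul h X Y Z x + h.inner x (cov.torsion x (X x) (Y x)) (Z x) / 2 := by
  -- The three brackets in the Koszul expression are traded for covariant derivatives and torsion;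
  -- total skewness collapses the three torsion terms into one.
  have eXY := congr(h.inner x $(cov.torsion_apply hX hY) (Z x))
  have eXZ := congr(h.inner x $(cov.torsion_apply hX hZ) (Y x))
  have eYZ := congr(h.inner x $(cov.torsion_apply hY hZ) (X x))
  simp only [map_sub, sub_apply] at eXY eXZ eYZ
  have sXYZ := (hskew x (X x) (Y x) (Z x)).2
  have sXZY := (hskew x (Y x) (X x) (Z x)).2
  have sYX := (hskew x (X x) (Y x) (Z x)).1
  simp only [koszul, hcov x Y Z hY hZ, hcov x X Z hX hZ, hcov x X Y hX hY]
  simp only [h.symm x (Y x) (cov _ _ _), h.symm x (X x) (cov _ _ _)]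
  linear_combination (-eXY + eXZ + eYZ - sXYZ - sXZY + sYX) / 2

/-- For every smooth 3-form `τ` there is a smooth metric connection with torsion `τ`. -/
theorem exists_isMetricConnection_torsion_eq
    (τ : (X Y Z : Π x : M, TangentSpace I x) → M → ℝ)
    (tensorial : ∀ {x} {Y Z : Π x : M, TangentSpace I x}, MDiffAt (T% Y) x →
      MDiffAt (T% Z) x → TensorialAt I E (τ · Y Z x) x)
    (swap_left : ∀ {x} {X Y Z : Π x : M, TangentSpace I x}, MDiffAt (T% X) x →
      MDiffAt (T% Y) x → MDiffAt (T% Z) x → τ X Y Z x = -τ Y X Z x)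
    (swap_right : ∀ {x} {X Y Z : Π x : M, TangentSpace I x}, MDiffAt (T% X) x →
      MDiffAt (T% Y) x → MDiffAt (T% Z) x → τ X Y Z x = -τ X Z Y x)
    (smooth : ∀ {x} {X Y Z : Π x : M, TangentSpace I x}, CMDiffAt ∞ (T% X) x →
      CMDiffAt ∞ (T% Y) x → CMDiffAt ∞ (T% Z) x → CMDiffAt ∞ (τ X Y Z) x) :
    ∃ cov : CovariantDerivative I E (fun x : M ↦ TangentSpace I x),
      cov.ContMDiffCovariantDerivative ∞ ∧ IsMetricConnection h cov ∧
      ∀ {x} {X Y Z : Π x : M, TangentSpace I x}, MDiffAt (T% X) x → MDiffAt (T% Y) x →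
        MDiffAt (T% Z) x → h.inner x (cov.torsion x (X x) (Y x)) (Z x) = τ X Y Z x := by
  have add_middle {x} {X Y Y' Z : Π x : M, TangentSpace I x} (hX : MDiffAt (T% X) x)
      (hY : MDiffAt (T% Y) x) (hY' : MDiffAt (T% Y') x) (hZ : MDiffAt (T% Z) x) :
      τ X (Y + Y') Z x = τ X Y Z x + τ X Y' Z x := by
    rw [swap_left hX (mdifferentiableAt_add_section hY hY') hZ, (tensorial hX hZ).add hY hY',
      swap_left hX hY hZ, swap_left hX hY' hZ]
    ring
  have smul_middle {x} {f : M → ℝ} {X Y Z : Π x : M, TangentSpace I x} (hf : MDiffAt f x)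
      (hX : MDiffAt (T% X) x) (hY : MDiffAt (T% Y) x) (hZ : MDiffAt (T% Z) x) :
      τ X (f • Y) Z x = f x * τ X Y Z x := by
    rw [swap_left hX (hf.smul_section hY) hZ, (tensorial hX hZ).smul hf hY, swap_left hX hY hZ,
      smul_eq_mul]
    ring
  obtain ⟨cov, hsmooth, hcov⟩ := exists_connection_inner_eq h
    -- Skewness of $\tau$ in the last two slots keeps the connection metric. Skewness in the first
    -- two makes the halves in $\nabla_XY-\nabla_YX$ add up to torsion $\tau$.
    (fun X Y Z x ↦ koszul h X Y Z x + τ X Y Z x / 2)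
    (fun hY hZ ↦
      { smul := fun hf hX ↦ by
          rw [koszul_smul_left h hf hX hY hZ, (tensorial hY hZ).smul hf hX, smul_eq_mul,
            smul_eq_mul]
          ring
        add := fun hX hX' ↦ by
          rw [koszul_add_left h hX hX' hY hZ, (tensorial hY hZ).add hX hX']
          ring })
    (fun hX hY ↦
      { smul := fun hf hZ ↦ by
          rw [koszul_smul_right h hf hX hY hZ, swap_right hX hY (hf.smul_section hZ),
            smul_middle hf hX hZ hY, swap_right hX hY hZ, smul_eq_mul]
          ring
        add := fun hZ hZ' ↦ by
          rw [koszul_add_right h hX hY hZ hZ', swap_right hX hY (mdifferentiableAt_add_section hZ hZ'),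
            add_middle hX hZ hZ' hY, swap_right hX hY hZ, swap_right hX hY hZ']
          ring })
    (fun hX hY hY' hZ ↦ by
      rw [koszul_add_middle h hX hY hY' hZ, add_middle hX hY hY' hZ]
      ring)
    (fun hf hX hY hZ ↦ by
      rw [koszul_smul_middle h hf hX hY hZ, smul_middle hf hX hY hZ]
      ring)
    (fun hX hY hZ ↦ (contMDiffAt_koszul h hX hY hZ).add ((smooth hX hY hZ).div_const 2))
  refine ⟨cov, hsmooth, fun x Y Z hY hZ u ↦ ?_, fun {x X Y Z} hX hY hZ ↦ ?_⟩
  · have hU : MDiffAt (T% (FiberBundle.extend E u)) x := FiberBundle.mdifferentiableAt_extend ..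
    have h₁ := hcov hU hY hZ
    have h₂ := hcov hU hZ hY
    have h₃ := koszul_add_swap_right h (FiberBundle.extend E u) Y Z x
    have h₄ := swap_right hU hY hZ
    rw [FiberBundle.extend_apply_self] at h₁ h₂ h₃
    rw [h.symm x (Y x)]
    linear_combination -h₁ - h₂ - h₃ - h₄ / 2
  · rw [cov.torsion_apply hX hY]
    simp only [map_sub, sub_apply]
    linear_combination hcov hX hY hZ - hcov hY hX hZ + koszul_sub_swap_left h X Y Z x -
      swap_left hX hY hZ / 2

theorem exists_isLeviCivita :
    ∃ lc : CovariantDerivative I E (fun x : M ↦ TangentSpace I x), IsLeviCivita h lc := by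
  obtain ⟨lc, hsmooth, hmetric, hlc⟩ := exists_isMetricConnection_torsion_eq h (fun _ _ _ _ ↦ 0)
    (fun _ _ ↦ { smul := by simp, add := by simp }) (by simp) (by simp)
    (fun _ _ _ ↦ contMDiffAt_const)
  refine ⟨lc, hsmooth, hmetric, ?_⟩
  ext x u v
  refine eq_of_inner_eq h fun w ↦ ?_
  have := hlc (x := x) (X := FiberBundle.extend E u) (Y := FiberBundle.extend E v)
    (Z := FiberBundle.extend E w) (FiberBundle.mdifferentiableAt_extend ..)
    (FiberBundle.mdifferentiableAt_extend ..) (FiberBundle.mdifferentiableAt_extend ..)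
  simpa using this

end Koszul

/-! ### $N_J$ and $d\Omega_J$ in terms of $\nabla J$ and torsion. -/

section EndomorphismDerivative

variable {E : Type*} [NormedAddCommGroup E] [NormedSpace ℝ E]
  {H : Type*} [TopologicalSpace H] {I : ModelWithCorners ℝ E H}
  {M : Type*} [TopologicalSpace M] [ChartedSpace H M] [IsManifold I ∞ M]

/-- The covariant derivative `(∇_u J) Y = ∇_u (JY) - J ∇_u Y` of a field of endomorphisms. -/
def endoDeriv (cov : CovariantDerivative I E (fun x : M ↦ TangentSpace I x))
    (J : Π x : M, TangentSpace I x →L[ℝ] TangentSpace I x) (Y : Π x : M, TangentSpace I x)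
    (x : M) : TangentSpace I x →L[ℝ] TangentSpace I x :=
  cov (applyField J Y) x - (J x).comp (cov Y x)

variable {h : ContMDiffRiemannianMetric I ∞ E (fun x : M ↦ TangentSpace I x)}
  {J : Π x : M, TangentSpace I x →L[ℝ] TangentSpace I x}
  {cov : CovariantDerivative I E (fun x : M ↦ TangentSpace I x)}
  {x : M} {X Y Z : Π x : M, TangentSpace I x}

lemma endoDeriv_apply (u : TangentSpace I x) :
    endoDeriv cov J Y x u = cov (applyField J Y) x u - J x (cov Y x u) := by
  simp [endoDeriv]

lemma isComplexConnection_iff_endoDeriv_eq_zero : IsComplexConnection J cov ↔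
    ∀ (x : M) (Y : Π x : M, TangentSpace I x), MDiffAt (T% Y) x → endoDeriv cov J Y x = 0 := by
  refine forall₃_congr fun x Y _ ↦ ?_
  rw [ContinuousLinearMap.ext_iff]
  simp [endoDeriv_apply, sub_eq_zero]

lemma applyField_applyField (hJ : IsAlmostHermitian h J) (X : Π x : M, TangentSpace I x) :
    applyField J (applyField J X) = (-1 : ℝ) • X := by
  funext x; simp [applyField, hJ.sq]

lemma inner_J_left (hJ : IsAlmostHermitian h J) (u v : TangentSpace I x) :
    h.inner x (J x u) v = -h.inner x u (J x v) := by
  rw [← hJ.orthogonal x (J x u) v, hJ.sq]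
  simp

lemma kahlerForm_swap (hJ : IsAlmostHermitian h J) (x : M) (u v : TangentSpace I x) :
    kahlerForm h J x u v = -kahlerForm h J x v u := by
  change h.inner x (J x u) v = -h.inner x (J x v) u
  rw [inner_J_left hJ, h.symm]

lemma isSmoothBilinForm_kahlerForm (hJ : IsAlmostHermitian h J) :
    IsSmoothBilinForm (kahlerForm h J) := by
  intro x
  have h₁ := h.contMDiff x
  have h₂ := hJ.smooth x
  rw [contMDiffAt_hom_bundle] at h₁ h₂ ⊢
  refine ⟨contMDiffAt_id, (h₁.2.clm_comp h₂.2).congr_of_eventuallyEq ?_⟩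
  have hx := FiberBundle.mem_baseSet_trivializationAt' (F := E)
    (E := fun x : M ↦ TangentSpace I x) x
  filter_upwards [(trivializationAt E (fun x : M ↦ TangentSpace I x) x).open_baseSet.mem_nhds hx]
    with y hy
  ext1 v
  simp only [ContinuousLinearMap.inCoordinates, kahlerForm, ContinuousLinearMap.comp_apply]
  -- On the base set the trivialization and its inverse cancel between the coordinate forms of $h$
  -- and $J$, so the coordinates of $\Omega_J$ are their composite.
  rw [Trivialization.symmL_continuousLinearMapAt _ hy]

/-- Differentiating $J^2=-1$ shows that $\nabla_uJ$ anticommutes with $J$, and $J$ is skew-adjoint.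
-/
lemma endoDeriv_applyField (hJ : IsAlmostHermitian h J) (hY : MDiffAt (T% Y) x)
    (u v : TangentSpace I x) :
    h.inner x (endoDeriv cov J (applyField J Y) x u) v =
      h.inner x (endoDeriv cov J Y x u) (J x v) := by
  simp only [endoDeriv_apply, applyField_applyField hJ,
    cov.isCovariantDerivativeOnUniv.smul_const (-1) hY]
  simp [inner_J_left hJ, hJ.sq]
  ring

/-- $J$ is skew-adjoint, and a metric connection preserves this under differentiation. -/
lemma endoDeriv_skew (hJ : IsAlmostHermitian h J) (hcov : IsMetricConnection h cov)
    (hY : MDiffAt (T% Y) x) (hZ : MDiffAt (T% Z) x) (u : TangentSpace I x) :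
    h.inner x (endoDeriv cov J Y x u) (Z x) = -h.inner x (endoDeriv cov J Z x u) (Y x) := by
  have h₁ := hcov x _ _ (mdifferentiableAt_applyField hJ.smooth hY) hZ u
  have h₂ := hcov x _ _ hY (mdifferentiableAt_applyField hJ.smooth hZ) u
  have h₃ : (fun y ↦ h.inner y (applyField J Y y) (Z y)) =
      -fun y ↦ h.inner y (Y y) (applyField J Z y) := by
    funext y; simp [applyField, inner_J_left hJ]
  rw [h₃, mvfderiv_neg] at h₁
  simp only [endoDeriv_apply, map_sub, sub_apply, neg_apply] at h₁ ⊢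
  simp only [applyField, inner_J_left hJ] at h₁ h₂ ⊢
  rw [h.symm x (Y x) (cov _ _ _)] at h₂
  rw [← inner_J_left hJ] at h₁
  linear_combination -h₁ - h₂ + h.symm x (cov Z x u) (J x (Y x))

variable [FiniteDimensional ℝ E] [CompleteSpace E]

/-- Each bracket is replaced by $[X,Y]=\nabla_XY-\nabla_YX-T(X,Y)$; the connection need not be
metric. -/
lemma nijenhuisField_eq_torsion (hJ : IsAlmostHermitian h J) (hX : MDiffAt (T% X) x)
    (hY : MDiffAt (T% Y) x) :
    nijenhuisField J X Y x =
      cov.torsion x (X x) (Y x) - cov.torsion x (J x (X x)) (J x (Y x))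
      + J x (cov.torsion x (J x (X x)) (Y x)) + J x (cov.torsion x (X x) (J x (Y x)))
      + endoDeriv cov J Y x (J x (X x)) - endoDeriv cov J X x (J x (Y x))
      + J x (endoDeriv cov J X x (Y x)) - J x (endoDeriv cov J Y x (X x)) := by
  have hJX := mdifferentiableAt_applyField hJ.smooth hX
  have hJY := mdifferentiableAt_applyField hJ.smooth hY
  have e₁ := cov.torsion_apply hX hY
  have e₂ := cov.torsion_apply hJX hJY
  have e₃ := cov.torsion_apply hJX hY
  have e₄ := cov.torsion_apply hX hJY
  simp only [applyField] at e₁ e₂ e₃ e₄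
  rw [e₁, e₂, e₃, e₄]
  simp only [nijenhuisField, endoDeriv_apply, map_sub, hJ.sq]
  abel

lemma extDerivField_kahlerForm_eq (hJ : IsAlmostHermitian h J) (hcov : IsMetricConnection h cov)
    (hX : MDiffAt (T% X) x) (hY : MDiffAt (T% Y) x) (hZ : MDiffAt (T% Z) x) :
    extDerivField (kahlerForm h J) X Y Z x =
      h.inner x (endoDeriv cov J Y x (X x)) (Z x) + h.inner x (endoDeriv cov J Z x (Y x)) (X x)
      + h.inner x (endoDeriv cov J X x (Z x)) (Y x)
      - h.inner x (cov.torsion x (X x) (Y x)) (J x (Z x))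
      + h.inner x (cov.torsion x (X x) (Z x)) (J x (Y x))
      - h.inner x (cov.torsion x (Y x) (Z x)) (J x (X x)) := by
  have hJX := mdifferentiableAt_applyField hJ.smooth hX
  have hJY := mdifferentiableAt_applyField hJ.smooth hY
  have d₁ := hcov x _ _ hJY hZ (X x)
  have d₂ := hcov x _ _ hJX hZ (Y x)
  have d₃ := hcov x _ _ hJX hY (Z x)
  -- The direct computation yields $-A(Y,X,Z)$; skewness turns it into the cyclic term $A(Y,Z,X)$.
  have s := endoDeriv_skew hJ hcov hX hZ (Y x)
  simp only [applyField] at d₁ d₂ d₃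
  rw [cov.torsion_apply hX hY, cov.torsion_apply hX hZ, cov.torsion_apply hY hZ]
  change d% (fun y ↦ h.inner y (J y (Y y)) (Z y)) x (X x)
    - d% (fun y ↦ h.inner y (J y (X y)) (Z y)) x (Y x)
    + d% (fun y ↦ h.inner y (J y (X y)) (Y y)) x (Z x)
    - h.inner x (J x (VectorField.mlieBracket I X Y x)) (Z x)
    + h.inner x (J x (VectorField.mlieBracket I X Z x)) (Y x)
    - h.inner x (J x (VectorField.mlieBracket I Y Z x)) (X x) = _
  rw [d₁, d₂, d₃]
  rw [h.symm x (J x (Y x)) (cov _ _ _), h.symm x (J x (X x)) (cov Z _ _),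
    h.symm x (J x (X x)) (cov Y _ _)]
  simp only [endoDeriv_apply, map_sub, sub_apply, inner_J_left hJ] at s ⊢
  linear_combination -s

end EndomorphismDerivative

/-! ### Uniqueness and existence of the characteristic connection. -/

section Characteristic

variable {E : Type*} [NormedAddCommGroup E] [NormedSpace ℝ E]
  {H : Type*} [TopologicalSpace H] {I : ModelWithCorners ℝ E H}
  {M : Type*} [TopologicalSpace M] [ChartedSpace H M] [IsManifold I ∞ M]
  [FiniteDimensional ℝ E] [CompleteSpace E]
  {h : ContMDiffRiemannianMetric I ∞ E (fun x : M ↦ TangentSpace I x)}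
  {J : Π x : M, TangentSpace I x →L[ℝ] TangentSpace I x}
  {cov cov' lc : CovariantDerivative I E (fun x : M ↦ TangentSpace I x)}

lemma IsComplexConnection.nijenhuis_eq (hJ : IsAlmostHermitian h J)
    (hcov : IsComplexConnection J cov) (x : M) (u v : TangentSpace I x) :
    nijenhuis J x u v = cov.torsion x u v - cov.torsion x (J x u) (J x v)
      + J x (cov.torsion x (J x u) v) + J x (cov.torsion x u (J x v)) := by
  have hu : MDiffAt (T% (FiberBundle.extend E u)) x := FiberBundle.mdifferentiableAt_extend ..
  have hv : MDiffAt (T% (FiberBundle.extend E v)) x := FiberBundle.mdifferentiableAt_extend ..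
  rw [isComplexConnection_iff_endoDeriv_eq_zero] at hcov
  rw [nijenhuis, nijenhuisField_eq_torsion (cov := cov) hJ hu hv, hcov x _ hu, hcov x _ hv]
  simp

lemma IsCharacteristicConnection.isTotallySkew_nijenhuis (hJ : IsAlmostHermitian h J)
    (hcov : IsCharacteristicConnection h J cov) : IsTotallySkew h (nijenhuis J) := by
  intro x u v w
  have hs := hcov.skew x
  simp only [hcov.hermitian.complex.nijenhuis_eq hJ, map_add, map_sub, add_apply, sub_apply,
    inner_J_left hJ]
  constructor
  · linear_combination (hs u v w).1 - (hs (J x u) (J x v) w).1 - (hs (J x u) v (J x w)).1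
      - (hs u (J x v) (J x w)).1
  · linear_combination (hs u v w).2 - (hs (J x u) (J x v) w).2 - (hs (J x u) v (J x w)).2
      - (hs u (J x v) (J x w)).2

lemma dcKahlerForm_apply (hJ : IsAlmostHermitian h J) {x : M} {X Y Z : Π x : M, TangentSpace I x}
    (hX : MDiffAt (T% X) x) (hY : MDiffAt (T% Y) x) (hZ : MDiffAt (T% Z) x) :
    dcKahlerForm h J x (X x) (Y x) (Z x) =
      -extDerivField (kahlerForm h J) (applyField J X) (applyField J Y) (applyField J Z) x := by
  rw [dcKahlerForm, ← extDerivTwoForm_apply (isSmoothBilinForm_kahlerForm hJ) (kahlerForm_swap hJ)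
    (mdifferentiableAt_applyField hJ.smooth hX) (mdifferentiableAt_applyField hJ.smooth hY)
    (mdifferentiableAt_applyField hJ.smooth hZ)]
  rfl

theorem IsCharacteristicConnection.inner_torsion (hJ : IsAlmostHermitian h J)
    (hcov : IsCharacteristicConnection h J cov) (x : M) (u v w : TangentSpace I x) :
    h.inner x (cov.torsion x u v) w =
      -dcKahlerForm h J x u v w + h.inner x (nijenhuis J x u v) w := by
  have hext (u : TangentSpace I x) : MDiffAt (T% (FiberBundle.extend E u)) x :=
    FiberBundle.mdifferentiableAt_extend ..
  have hJext (u : TangentSpace I x) : MDiffAt (T% (applyField J (FiberBundle.extend E u))) x :=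
    mdifferentiableAt_applyField hJ.smooth (hext u)
  have hD := isComplexConnection_iff_endoDeriv_eq_zero.mp hcov.hermitian.complex x
  have hdc := dcKahlerForm_apply hJ (hext u) (hext v) (hext w)
  rw [extDerivField_kahlerForm_eq hJ hcov.hermitian.metric (hJext u) (hJext v) (hJext w),
    hD _ (hJext u), hD _ (hJext v), hD _ (hJext w)] at hdc
  simp only [FiberBundle.extend_apply_self, applyField] at hdc
  rw [hdc, hcov.hermitian.complex.nijenhuis_eq hJ]
  -- Terms of $N_J$ and $d\Omega_J(J\cdot,J\cdot,J\cdot)$ with two arguments rotated by $J$ cancel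
  -- in pairs, leaving $T(u,v,w)$.
  have h₁ := hcov.skew x (J x u) (J x w) v
  have h₂ := hcov.skew x (J x v) (J x w) u
  have h₃ := hcov.skew x u (J x v) (J x w)
  simp [inner_J_left hJ, hJ.sq]
  linear_combination h₁.2 - h₂.2 + h₃.1

lemma IsTotallySkew.of_torsion_eq_zero (hcov : cov.torsion = 0) :
    IsTotallySkew h (fun x u v ↦ cov.torsion x u v) := by
  intro x u v w
  simp [hcov]

/-- Both torsions equal the same explicit form, and the Koszul formula recovers the connection from
its torsion. -/
theorem IsCharacteristicConnection.sameConnection (hJ : IsAlmostHermitian h J)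
    (hcov : IsCharacteristicConnection h J cov) (hcov' : IsCharacteristicConnection h J cov') :
    SameConnection cov cov' := by
  intro x Y hY u
  refine eq_of_inner_eq h fun w ↦ ?_
  have hu : MDiffAt (T% (FiberBundle.extend E u)) x := FiberBundle.mdifferentiableAt_extend ..
  have hw : MDiffAt (T% (FiberBundle.extend E w)) x := FiberBundle.mdifferentiableAt_extend ..
  have h₁ := hcov.hermitian.metric.inner_eq_koszul hcov.skew hu hY hw
  have h₂ := hcov'.hermitian.metric.inner_eq_koszul hcov'.skew hu hY hw
  simp only [hcov.inner_torsion hJ, hcov'.inner_torsion hJ, FiberBundle.extend_apply_self] at h₁ h₂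
  rw [h₁, h₂]

theorem IsCharacteristicConnection.isSumConnection
    (hcov : IsCharacteristicConnection h J cov) (hlc : IsLeviCivita h lc) :
    IsSumConnection cov lc (1 / 2) cov.torsion := by
  intro x Y hY u
  refine eq_of_inner_eq h fun w ↦ ?_
  have hu : MDiffAt (T% (FiberBundle.extend E u)) x := FiberBundle.mdifferentiableAt_extend ..
  have hw : MDiffAt (T% (FiberBundle.extend E w)) x := FiberBundle.mdifferentiableAt_extend ..
  have h₁ := hcov.hermitian.metric.inner_eq_koszul hcov.skew hu hY hw
  have h₂ := hlc.metric.inner_eq_koszul (.of_torsion_eq_zero hlc.torsionFree) hu hY hw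
  simp only [FiberBundle.extend_apply_self] at h₁ h₂
  simp [hlc.torsionFree] at h₂
  rw [h₁, map_add, add_apply, h₂]
  simp
  ring

/-- If the torsion of a metric connection is the 3-form `-d^c Ω_J + N_J`, then the connection
preserves `J`. -/
lemma IsMetricConnection.isComplexConnection (hJ : IsAlmostHermitian h J)
    (hcov : IsMetricConnection h cov) (hskew : IsTotallySkew h (fun x u v ↦ cov.torsion x u v))
    (hT : ∀ (x : M) (u v w : TangentSpace I x), h.inner x (cov.torsion x u v) w =
      -dcKahlerForm h J x u v w + h.inner x (nijenhuis J x u v) w) :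
    IsComplexConnection J cov := by
  rw [isComplexConnection_iff_endoDeriv_eq_zero]
  intro x Y₀ hY₀
  -- Expanding the hypothesis `hT`, the torsion cancels as in
  -- `IsCharacteristicConnection.inner_torsion`. The terms $A(JX,Y,Z)$ cancel too, and those
  -- differentiating along $JY$ vanish by skewness `s`.
  have key {X Y Z : Π x : M, TangentSpace I x} (hX : MDiffAt (T% X) x) (hY : MDiffAt (T% Y) x)
      (hZ : MDiffAt (T% Z) x) :
      h.inner x (endoDeriv cov J X x (J x (Z x))) (Y x) =
        h.inner x (endoDeriv cov J Y x (X x)) (J x (Z x))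
          - h.inner x (endoDeriv cov J X x (Y x)) (J x (Z x)) := by
    have hJX := mdifferentiableAt_applyField hJ.smooth hX
    have hJY := mdifferentiableAt_applyField hJ.smooth hY
    have hJZ := mdifferentiableAt_applyField hJ.smooth hZ
    have e := hT x (X x) (Y x) (Z x)
    rw [dcKahlerForm_apply hJ hX hY hZ, extDerivField_kahlerForm_eq hJ hcov hJX hJY hJZ,
      nijenhuis_apply hJ.smooth hJ.sq hX hY, nijenhuisField_eq_torsion (cov := cov) hJ hX hY] at e
    simp only [endoDeriv_applyField hJ hX, endoDeriv_applyField hJ hY, endoDeriv_applyField hJ hZ]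
      at e
    have s := endoDeriv_skew hJ hcov hZ hX (J x (Y x))
    simp [applyField, hJ.sq, inner_J_left hJ] at e
    have h₁ := hskew x (J x (X x)) (J x (Z x)) (Y x)
    have h₂ := hskew x (J x (Y x)) (J x (Z x)) (X x)
    have h₃ := hskew x (X x) (J x (Y x)) (J x (Z x))
    linear_combination e - s - (h₁.2 - h₂.2 + h₃.1)
  -- Replacing $Z$ by $JZ$ removes $J$. With skewness this reads $A(Z,X,Y)=A(X,Y,Z)+A(Y,Z,X)$;
  -- adding two cyclic instances, `k₁` and `k₂`, gives $2A(u,Y_0,w)=0$.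
  have key' {X Y Z : Π x : M, TangentSpace I x} (hX : MDiffAt (T% X) x) (hY : MDiffAt (T% Y) x)
      (hZ : MDiffAt (T% Z) x) :
      h.inner x (endoDeriv cov J X x (Z x)) (Y x) =
        h.inner x (endoDeriv cov J Y x (X x)) (Z x)
          - h.inner x (endoDeriv cov J X x (Y x)) (Z x) := by
    have := key hX hY (mdifferentiableAt_applyField hJ.smooth hZ)
    simp only [applyField, hJ.sq, map_neg, neg_apply] at this
    linear_combination -this
  ext u
  refine eq_of_inner_eq h fun w ↦ ?_
  have hU : MDiffAt (T% (FiberBundle.extend E u)) x := FiberBundle.mdifferentiableAt_extend ..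
  have hW : MDiffAt (T% (FiberBundle.extend E w)) x := FiberBundle.mdifferentiableAt_extend ..
  have k₁ := key' hW hU hY₀
  have k₂ := key' hU hY₀ hW
  have s₁ := endoDeriv_skew hJ hcov hW hY₀ u
  have s₂ := endoDeriv_skew hJ hcov hU hW (Y₀ x)
  simp only [FiberBundle.extend_apply_self] at k₁ k₂ s₁ s₂
  simp only [zero_apply, map_zero]
  linear_combination (-k₁ - k₂ + s₁ + s₂) / 2

theorem exists_isCharacteristicConnection (hJ : IsAlmostHermitian h J)
    (hN : IsTotallySkew h (nijenhuis J)) :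
    ∃ cov : CovariantDerivative I E (fun x : M ↦ TangentSpace I x),
      IsCharacteristicConnection h J cov := by
  have hΩ := isSmoothBilinForm_kahlerForm hJ
  obtain ⟨cov, hsmooth, hmetric, htorsion⟩ := exists_isMetricConnection_torsion_eq h
    -- The two minus signs in $-d^c\Omega_J$ cancel, leaving $d\Omega_J(JX,JY,JZ)$.
    (fun X Y Z x ↦
      extDerivField (kahlerForm h J) (applyField J X) (applyField J Y) (applyField J Z) x
      + h.inner x (nijenhuisField J X Y x) (Z x))
    (fun {x Y Z} hY hZ ↦
      { smul := fun hf hX ↦ by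
          rw [applyField_smul, (tensorial_extDerivField hΩ x
              (mdifferentiableAt_applyField hJ.smooth hY)
              (mdifferentiableAt_applyField hJ.smooth hZ)).smul hf
              (mdifferentiableAt_applyField hJ.smooth hX),
            (tensorial_nijenhuisField hJ.smooth hJ.sq x Y).smul hf hX]
          simp
          ring
        add := fun hX hX' ↦ by
          rw [applyField_add, (tensorial_extDerivField hΩ x
              (mdifferentiableAt_applyField hJ.smooth hY)
              (mdifferentiableAt_applyField hJ.smooth hZ)).add
              (mdifferentiableAt_applyField hJ.smooth hX)
              (mdifferentiableAt_applyField hJ.smooth hX'),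
            (tensorial_nijenhuisField hJ.smooth hJ.sq x Y).add hX hX']
          simp
          ring })
    (fun {x X Y Z} _ _ _ ↦ by
      rw [extDerivField_swap₁ _ _ _ _ (kahlerForm_swap hJ), nijenhuisField_swap J X Y]
      simp
      ring)
    -- Skewness in the last two slots is what requires `hN`; in the first two it is automatic.
    (fun {x X Y Z} hX hY hZ ↦ by
      rw [extDerivField_swap₂ _ _ _ _ (kahlerForm_swap hJ),
        ← nijenhuis_apply hJ.smooth hJ.sq hX hY, ← nijenhuis_apply hJ.smooth hJ.sq hX hZ,
        (hN x (X x) (Y x) (Z x)).2]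
      ring)
    (fun hX hY hZ ↦ (contMDiffAt_extDerivField hΩ (contMDiffAt_applyField hJ.smooth hX)
      (contMDiffAt_applyField hJ.smooth hY) (contMDiffAt_applyField hJ.smooth hZ)).add
      (contMDiffAt_bilin_apply h.contMDiff (contMDiffAt_nijenhuisField hJ.smooth hX hY) hZ))
  have hT (x : M) (u v w : TangentSpace I x) : h.inner x (cov.torsion x u v) w =
      -dcKahlerForm h J x u v w + h.inner x (nijenhuis J x u v) w := by
    have hext (u : TangentSpace I x) : MDiffAt (T% (FiberBundle.extend E u)) x :=
      FiberBundle.mdifferentiableAt_extend ..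
    have e := htorsion (hext u) (hext v) (hext w)
    have hdc := dcKahlerForm_apply hJ (hext u) (hext v) (hext w)
    have hn := nijenhuis_apply hJ.smooth hJ.sq (hext u) (hext v)
    simp only [FiberBundle.extend_apply_self] at e hdc hn
    rw [e, hdc, hn, neg_neg]
  have hskew : IsTotallySkew h (fun x u v ↦ cov.torsion x u v) := by
    intro x u v w
    have hΩs := kahlerForm_swap hJ
    have hd₁ : dcKahlerForm h J x u v w = -dcKahlerForm h J x v u w := by
      rw [dcKahlerForm, extDerivTwoForm, extDerivField_swap₁ _ _ _ _ hΩs]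
      rfl
    have hd₂ : dcKahlerForm h J x u v w = -dcKahlerForm h J x u w v := by
      rw [dcKahlerForm, extDerivTwoForm, extDerivField_swap₂ _ _ _ _ hΩs]
      rfl
    simp only [hT]
    constructor
    · linear_combination (hN x u v w).1 - hd₁
    · linear_combination (hN x u v w).2 - hd₂
  exact ⟨cov, ⟨hsmooth, hmetric, hmetric.isComplexConnection hJ hskew hT⟩, hskew⟩

end Characteristic

end AlmostHermitian

end

theorem mainTheorem1 {n : ℕ}
    {N : Type*} [TopologicalSpace N] [T2Space N]
    [ChartedSpace (EuclideanSpace ℝ (Fin n)) N] [IsManifold (𝓡 n) ∞ N]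
    (h : ContMDiffRiemannianMetric (𝓡 n) ∞ (EuclideanSpace ℝ (Fin n))
      (fun x : N ↦ TangentSpace (𝓡 n) x))
    (J : Π x : N, TangentSpace (𝓡 n) x →L[ℝ] TangentSpace (𝓡 n) x)
    (hJ : AlmostHermitian.IsAlmostHermitian h J) :
    ((∃ cov : CovariantDerivative (𝓡 n) (EuclideanSpace ℝ (Fin n))
          (fun x : N ↦ TangentSpace (𝓡 n) x),
        AlmostHermitian.IsCharacteristicConnection h J cov) ↔
      AlmostHermitian.IsTotallySkew h (AlmostHermitian.nijenhuis J)) ∧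
    (∀ cov cov' : CovariantDerivative (𝓡 n) (EuclideanSpace ℝ (Fin n))
          (fun x : N ↦ TangentSpace (𝓡 n) x),
      AlmostHermitian.IsCharacteristicConnection h J cov →
      AlmostHermitian.IsCharacteristicConnection h J cov' →
      AlmostHermitian.SameConnection cov cov') ∧
    (∀ cov : CovariantDerivative (𝓡 n) (EuclideanSpace ℝ (Fin n))
          (fun x : N ↦ TangentSpace (𝓡 n) x),
      AlmostHermitian.IsCharacteristicConnection h J cov →
      (∀ (x : N) (u v w : TangentSpace (𝓡 n) x),
        h.inner x (cov.torsion x u v) w =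
          -AlmostHermitian.dcKahlerForm h J x u v w
            + h.inner x (AlmostHermitian.nijenhuis J x u v) w) ∧
      (∃ lc : CovariantDerivative (𝓡 n) (EuclideanSpace ℝ (Fin n))
          (fun x : N ↦ TangentSpace (𝓡 n) x), AlmostHermitian.IsLeviCivita h lc) ∧
      (∀ lc : CovariantDerivative (𝓡 n) (EuclideanSpace ℝ (Fin n))
          (fun x : N ↦ TangentSpace (𝓡 n) x), AlmostHermitian.IsLeviCivita h lc →
        AlmostHermitian.IsSumConnection cov lc (1 / 2) cov.torsion)) := by
  refine ⟨⟨fun ⟨_, hcov⟩ ↦ hcov.isTotallySkew_nijenhuis hJ,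
    fun hN ↦ AlmostHermitian.exists_isCharacteristicConnection hJ hN⟩,
    fun _ _ hcov hcov' ↦ hcov.sameConnection hJ hcov',
    fun _ hcov ↦ ⟨hcov.inner_torsion hJ, AlmostHermitian.exists_isLeviCivita h,
      fun _ hlc ↦ hcov.isSumConnection hlc⟩⟩
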